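/- Theorem 5.3 (Quillen, homological version). For a finite poset $P$, let $\mathcal{K}(P)$ denote its order complex, i.e. the simplicial complex whose vertices are the points of $P$ and whose simplices are the nonempty chains of $P$. An order-preserving map $f:X\to Y$ of finite posets induces a simplicial map $\mathcal{K}(f):\mathcal{K}(X)\to\mathcal{K}(Y)$. For $i\in\mathbb{Z}$, let $\widetilde{H}_i(K)$ denote the $i$-th reduced integral homology group of a simplicial complex $K$, i.e. the $i$-th homology of its augmented simplicial chain complex, so that $\widetilde{H}_{-1}(\emptyset)=\mathbb{Z}$, $\widetilde{H}_{-1}(K)=0$ for $K\neq\emptyset$, and $\widetilde{H}_i(K)=0$ for $i<-1$. For $y\in Y$, put $U_y=\{y'\in Y \mid y'\le y\}$. Let $f:X\to Y$ be an order-preserving map between two finite posets and let $n\ge 0$ be an integer. Suppose that for every $y\in Y$ the groups $\widetilde{H}_i(\mathcal{K}(f^{-1}(U_y)))$ are trivial for all integers $i\le n$ (in particular, $f^{-1}(U_y)$ is nonempty). Then the induced homomorphism $$\mathcal{K}(f)_*:\widetilde{H}_i(\mathcal{K}(X))\to\widetilde{H}_i(\mathcal{K}(Y))$$ is an isomorphism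 for every integer $i\le n$ and an epimorphism for $i=n+1$. -/

import Mathlib

open CategoryTheory CategoryTheory.Limits

universe u

noncomputable section

/-- A simplicial map between abstract simplicial complexes: a map between the vertices that sends
faces to faces. -/
structure SimplicialMap {V W : Type u} (K : AbstractSimplicialComplex V)
    (L : AbstractSimplicialComplex W) where
  /-- the map on vertices -/
  toFun : V → W
  /-- the image of a face is a face -/
  image_mem : ∀ s ∈ K.faces, (open Classical in s.image toFun) ∈ L.faces

/-! ### The order complex of a poset -/

/-- The order complex of a poset `X`: its vertices are the points of `X`, and its simplices are the
nonempty finite chains of `X`. -/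
def orderComplex (X : Type u) [PartialOrder X] : AbstractSimplicialComplex X where
  faces := {s | s.Nonempty ∧ IsChain (· ≤ ·) (s : Set X)}
  isRelLowerSet_faces := by
    rintro s ⟨hs, hc⟩
    exact ⟨hs, fun t hts ht => ⟨ht, hc.mono (Finset.coe_subset.2 hts)⟩⟩
  singleton_mem v := ⟨Finset.singleton_nonempty v, by simp⟩

/-- The simplicial map between order complexes induced by an order-preserving map. -/
def orderComplexMap {X Y : Type u} [PartialOrder X] [PartialOrder Y] (f : X →o Y) :
    SimplicialMap (orderComplex X) (orderComplex Y) where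
  toFun := f
  image_mem := by
    classical
    rintro s ⟨hs, hc⟩
    refine ⟨hs.image _, ?_⟩
    rw [Finset.coe_image]
    rintro _ ⟨a, ha, rfl⟩ _ ⟨b, hb, rfl⟩ -
    exact (hc.total ha hb).imp (fun h => f.monotone h) (fun h => f.monotone h)

/-! ### Reduced simplicial homology with integer coefficients

We use the augmented ordered chain complex of an abstract simplicial complex `K`. In degree `i` it
is the free abelian group on the sequences `(v₀, …, vᵢ)` of vertices (repetitions allowed) which
span a simplex of `K`; in degree `-1` it is the free abelian group on the empty sequence, and it is
zero in degrees below `-1`. The boundary of `(v₀, …, vᵢ)` is `∑ₖ (-1)ᵏ (v₀, …, v̂ₖ, …, vᵢ)`; in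
particular, the boundary from degree `0` to degree `-1` is the augmentation. -/

/-- The ordered simplices of dimension `i` of `K`: sequences of `i + 1` vertices whose set of entries
is a simplex. The empty sequence is the only one of dimension `-1`. -/
def OrderedSimplex {V : Type u} (K : AbstractSimplicialComplex V) (i : ℤ) : Type u :=
  {l : List V // (l.length : ℤ) = i + 1 ∧ (l = [] ∨ (open Classical in l.toFinset) ∈ K.faces)}

namespace OrderedSimplex

variable {V W : Type u} {K : AbstractSimplicialComplex V} {L : AbstractSimplicialComplex W}

/-- The `k`-th face of an ordered simplex, obtained by deleting its entry of index `k`. -/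
def face {i : ℤ} (σ : OrderedSimplex K (i + 1)) (k : Fin σ.1.length) : OrderedSimplex K i :=
  ⟨σ.1.eraseIdx k, by
    classical
    obtain ⟨l, hl, h⟩ := σ
    have h1 := List.length_eraseIdx_of_lt k.2
    have h2 := k.2
    dsimp only at h1 h2 k ⊢
    refine ⟨by omega, ?_⟩
    by_cases he : l.eraseIdx k = []
    · exact Or.inl he
    · right
      have hne : l ≠ [] := by rintro rfl; simp at he
      have hf := h.resolve_left hne
      have := @(K.isRelLowerSet_faces hf).2 (l.eraseIdx k).toFinset
      convert this ?_ ?_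
      · intro v hv
        rw [List.mem_toFinset] at hv ⊢
        exact List.mem_of_mem_eraseIdx hv
      · exact (List.toFinset_nonempty_iff _).2 he⟩

/-- The image of an ordered simplex under a simplicial map, applied entrywise. -/
def map (φ : SimplicialMap K L) {i : ℤ} (σ : OrderedSimplex K i) : OrderedSimplex L i :=
  ⟨σ.1.map φ.toFun, by
    classical
    obtain ⟨l, hl, h⟩ := σ
    refine ⟨by simpa using hl, ?_⟩
    rcases h with h | h
    · left; simp [h]
    · right
      convert φ.image_mem _ h using 1
      ext v
      simp⟩

end OrderedSimplex

namespace AbstractSimplicialComplex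

variable {V W : Type u}

/-- The boundary homomorphism from degree `i + 1` to degree `i` of the augmented ordered chain
complex: the alternating sum of the faces. -/
def boundary (K : AbstractSimplicialComplex V) (i : ℤ) :
    (OrderedSimplex K (i + 1) →₀ ℤ) →ₗ[ℤ] (OrderedSimplex K i →₀ ℤ) :=
  Finsupp.linearCombination ℤ fun σ =>
    ∑ k : Fin σ.1.length, (-1 : ℤ) ^ (k : ℕ) • Finsupp.single (σ.face k) 1

/-- Auxiliary: the alternating sum of the faces of an arbitrary list. -/
def listBoundary (V : Type u) : (List V →₀ ℤ) →ₗ[ℤ] (List V →₀ ℤ) :=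
  Finsupp.linearCombination ℤ fun l =>
    ∑ k : Fin l.length, (-1 : ℤ) ^ (k : ℕ) • Finsupp.single (l.eraseIdx k) 1

theorem listBoundary_cons (a : V) (l : List V) :
    listBoundary V (Finsupp.single (a :: l) 1) =
      Finsupp.single l 1 -
        Finsupp.lmapDomain ℤ ℤ (List.cons a) (listBoundary V (Finsupp.single l 1)) := by
  simp only [listBoundary, Finsupp.linearCombination_single, one_smul, map_sum]
  rw [show (∑ k : Fin (a :: l).length, (-1 : ℤ) ^ (k : ℕ) •
      (Finsupp.single ((a :: l).eraseIdx k) 1 : List V →₀ ℤ)) =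
      ∑ k : Fin (l.length + 1), (-1 : ℤ) ^ (k : ℕ) •
      (Finsupp.single ((a :: l).eraseIdx k) 1 : List V →₀ ℤ) from rfl, Fin.sum_univ_succ]
  simp [pow_succ, Finsupp.mapDomain_single, sub_eq_add_neg, Finset.sum_neg_distrib]

theorem listBoundary_cons' (a : V) (x : List V →₀ ℤ) :
    listBoundary V (Finsupp.lmapDomain ℤ ℤ (List.cons a) x) =
      x - Finsupp.lmapDomain ℤ ℤ (List.cons a) (listBoundary V x) := by
  have : (listBoundary V).comp (Finsupp.lmapDomain ℤ ℤ (List.cons a)) =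
      LinearMap.id - (Finsupp.lmapDomain ℤ ℤ (List.cons a)).comp (listBoundary V) := by
    ext1 l
    ext1
    simpa [Finsupp.mapDomain_single] using listBoundary_cons a l
  exact LinearMap.congr_fun this x

theorem listBoundary_listBoundary (x : List V →₀ ℤ) : listBoundary V (listBoundary V x) = 0 := by
  have : (listBoundary V).comp (listBoundary V) = 0 := by
    ext1 l
    ext1
    simp only [LinearMap.comp_apply, Finsupp.lsingle_apply, LinearMap.zero_apply]
    induction l with
    | nil => simp [listBoundary]
    | cons a l ih =>
      rw [listBoundary_cons, map_sub, listBoundary_cons', ih, map_zero, sub_zero, sub_self]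
  exact LinearMap.congr_fun this x

/-- Auxiliary: forget that a sequence of vertices spans a simplex. -/
def toLists (K : AbstractSimplicialComplex V) (i : ℤ) :
    (OrderedSimplex K i →₀ ℤ) →ₗ[ℤ] (List V →₀ ℤ) :=
  Finsupp.lmapDomain ℤ ℤ fun σ => σ.1

theorem toLists_injective (K : AbstractSimplicialComplex V) (i : ℤ) :
    Function.Injective (K.toLists i) :=
  Finsupp.mapDomain_injective Subtype.val_injective

theorem toLists_boundary (K : AbstractSimplicialComplex V) (i : ℤ)
    (x : OrderedSimplex K (i + 1) →₀ ℤ) :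
    K.toLists i (K.boundary i x) = listBoundary V (K.toLists (i + 1) x) := by
  have : (K.toLists i).comp (K.boundary i) = (listBoundary V).comp (K.toLists (i + 1)) := by
    ext1 σ
    ext1
    simp only [LinearMap.comp_apply, Finsupp.lsingle_apply, toLists, boundary, listBoundary,
      Finsupp.linearCombination_single, one_smul, map_sum, map_smul, Finsupp.lmapDomain_apply,
      Finsupp.mapDomain_single]
    rfl
  exact LinearMap.congr_fun this x

theorem boundary_boundary (K : AbstractSimplicialComplex V) (i : ℤ)
    (x : OrderedSimplex K (i + 1 + 1) →₀ ℤ) : K.boundary i (K.boundary (i + 1) x) = 0 := by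
  apply K.toLists_injective i
  rw [toLists_boundary, toLists_boundary, listBoundary_listBoundary, map_zero]

/-- The augmented ordered chain complex of an abstract simplicial complex. -/
def augmentedChainComplex (K : AbstractSimplicialComplex V) : ChainComplex (ModuleCat.{u} ℤ) ℤ :=
  ChainComplex.of (fun i => ModuleCat.of ℤ (OrderedSimplex K i →₀ ℤ))
    (fun i => ModuleCat.ofHom (K.boundary i))
    (fun i => by ext1; exact LinearMap.ext (K.boundary_boundary i))

theorem augmentedChainComplex_d (K : AbstractSimplicialComplex V) (i : ℤ) :
    K.augmentedChainComplex.d (i + 1) i = ModuleCat.ofHom (K.boundary i) :=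
  ChainComplex.of_d (fun i => ModuleCat.of ℤ (OrderedSimplex K i →₀ ℤ))
    (fun i => ModuleCat.ofHom (K.boundary i)) i

/-- The reduced integral homology group `H̃ᵢ(K)` of an abstract simplicial complex, `i : ℤ`. -/
def reducedHomology (K : AbstractSimplicialComplex V) (i : ℤ) : ModuleCat.{u} ℤ :=
  K.augmentedChainComplex.homology i

end AbstractSimplicialComplex

namespace SimplicialMap

variable {V W : Type u} {K : AbstractSimplicialComplex V} {L : AbstractSimplicialComplex W}

/-- The homomorphism induced by a simplicial map on ordered chains:
`(v₀, …, vᵢ) ↦ (φ v₀, …, φ vᵢ)`. -/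
def chainMap (φ : SimplicialMap K L) (i : ℤ) :
    (OrderedSimplex K i →₀ ℤ) →ₗ[ℤ] (OrderedSimplex L i →₀ ℤ) :=
  Finsupp.lmapDomain ℤ ℤ (OrderedSimplex.map φ)

theorem boundary_chainMap (φ : SimplicialMap K L) (i : ℤ) (x : OrderedSimplex K (i + 1) →₀ ℤ) :
    L.boundary i (φ.chainMap (i + 1) x) = φ.chainMap i (K.boundary i x) := by
  have : (L.boundary i).comp (φ.chainMap (i + 1)) = (φ.chainMap i).comp (K.boundary i) := by
    ext1 σ
    ext1
    simp only [LinearMap.comp_apply, Finsupp.lsingle_apply, chainMap, Finsupp.lmapDomain_apply,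
      Finsupp.mapDomain_single, AbstractSimplicialComplex.boundary,
      Finsupp.linearCombination_single, one_smul]
    rw [← Finsupp.lmapDomain_apply ℤ ℤ, map_sum]
    refine Fintype.sum_equiv (finCongr (by simp [OrderedSimplex.map])) _ _ fun k => ?_
    simp only [map_smul, Finsupp.lmapDomain_apply, Finsupp.mapDomain_single, finCongr_apply,
      Fin.val_cast]
    congr 2
    apply Subtype.ext
    simp only [OrderedSimplex.face, OrderedSimplex.map, List.eraseIdx_map]
    rfl
  exact LinearMap.congr_fun this x

/-- The chain map between augmented ordered chain complexes induced by a simplicial map. -/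
def augmentedChainMap (φ : SimplicialMap K L) :
    K.augmentedChainComplex ⟶ L.augmentedChainComplex :=
  ChainComplex.ofHom (fun i => ModuleCat.ofHom (φ.chainMap i)) (fun i => by
    rw [AbstractSimplicialComplex.augmentedChainComplex_d,
      AbstractSimplicialComplex.augmentedChainComplex_d]
    ext1
    exact LinearMap.ext (φ.boundary_chainMap i))

/-- The homomorphism `H̃ᵢ(K) → H̃ᵢ(L)` induced by a simplicial map. -/
def reducedHomologyMap (φ : SimplicialMap K L) (i : ℤ) :
    K.reducedHomology i ⟶ L.reducedHomology i :=
  HomologicalComplex.homologyMap φ.augmentedChainMap i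

end SimplicialMap

end

open AbstractSimplicialComplex

/-! ### Homology in terms of elements -/

section homology

variable {R : Type} [CommRing R] {ι : Type*} {c : ComplexShape ι}
  {K L : HomologicalComplex (ModuleCat.{u} R) c}

/-! The proof is by acyclic carriers. A nonempty chain `l` of `Y` with maximum `y` carries the fibre
`f⁻¹(U_y)`, which grows with `l`. Defining `g l` requires a cycle of degree `dim l - 1` to bound in
that fibre, so acyclicity up to degree `n` yields a chain map `g` from `Y` to `X` in degrees at most
`n + 1` (`exists_carried_chainMap`).

Both `f g` and the identity are carried by the cones `U_y`, so they are homotopic wherever `g` is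
controlled, up to degree `n + 1` (`exists_homotopy_target`). Both `g f` and the identity are carried
by the fibres over the images of chains of `X`. A homotopy on `l` now requires cycles of degree `dim
l` to bound, so it exists only up to degree `n` (`exists_homotopy_source`). The first homotopy gives
surjectivity up to `n + 1`, the second injectivity up to `n`.

All three maps come from one induction on length, `exists_carried_map`. It runs in the free group on
all lists, where every degree, including `-1` (the empty list), is treated uniformly. -/

theorem exists_linearMap_lift {M : Type*} {N : Type*} [AddCommGroup N] [Module R N]
    (p : M → N → Prop) (hp : ∀ m, ∃ n, p m n) :
    ∃ F : (M →₀ R) →ₗ[R] N, ∀ m, p m (F (Finsupp.single m 1)) := by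
  choose F hF using hp
  exact ⟨Finsupp.linearCombination R F, fun m => by simpa using hF m⟩

theorem epi_linearCombination_id (M : ModuleCat.{u} R) :
    Epi (ModuleCat.ofHom (Finsupp.linearCombination R (id : M → M))) := by
  rw [ModuleCat.epi_iff_surjective]
  exact fun m => ⟨Finsupp.single m 1, by simp⟩

/-- A criterion in terms of elements for a chain map to be surjective on homology. -/
theorem epi_homologyMap_of_elements (φ : K ⟶ L) (i j k : ι) (hi : c.prev j = i) (hk : c.next j = k)
    (h : ∀ y : L.X j, L.d j k y = 0 →
      ∃ x : K.X j, K.d j k x = 0 ∧ ∃ w : L.X i, y = φ.f j x + L.d i j w) :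
    Epi (HomologicalComplex.homologyMap φ j) := by
  rw [HomologicalComplex.epi_homologyMap_iff_up_to_refinements φ i j k hi hk]
  intro A y hy
  -- Preimages chosen element by element need not depend linearly on `a`. They do extend linearly to
  -- the free module on the underlying set of `A`, whose surjection onto `A` serves as the
  -- refinement.
  obtain ⟨F, hF⟩ := exists_linearMap_lift (R := R) (M := A)
    (fun a (q : K.X j × L.X i) => K.d j k q.1 = 0 ∧ y a = φ.f j q.1 + L.d i j q.2) (fun a => by
      obtain ⟨x, hx, w, hw⟩ := h (y a) (by
        have := ConcreteCategory.congr_hom hy a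
        simpa using this)
      exact ⟨(x, w), hx, hw⟩)
  refine ⟨ModuleCat.of R (A →₀ R), _, epi_linearCombination_id A,
    ModuleCat.ofHom (LinearMap.fst R _ _ ∘ₗ F), ?_, ModuleCat.ofHom (LinearMap.snd R _ _ ∘ₗ F), ?_⟩
  · ext a
    simpa using (hF a).1
  · ext a
    simpa using (hF a).2

/-- A criterion in terms of elements for a chain map to be injective on homology. -/
theorem mono_homologyMap_of_elements (φ : K ⟶ L) (i j k : ι) (hi : c.prev j = i)
    (hk : c.next j = k)
    (h : ∀ x : K.X j, K.d j k x = 0 → ∀ w : L.X i, φ.f j x = L.d i j w →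
      ∃ v : K.X i, x = K.d i j v) :
    Mono (HomologicalComplex.homologyMap φ j) := by
  rw [HomologicalComplex.mono_homologyMap_iff_up_to_refinements φ i j k hi hk]
  intro A x hx w hw
  obtain ⟨F, hF⟩ := exists_linearMap_lift (R := R) (M := A)
    (fun a (v : K.X i) => x a = K.d i j v) (fun a => by
      refine h (x a) ?_ (w a) ?_
      · simpa using ConcreteCategory.congr_hom hx a
      · simpa using ConcreteCategory.congr_hom hw a)
  refine ⟨ModuleCat.of R (A →₀ R), _, epi_linearCombination_id A, ModuleCat.ofHom F, ?_⟩
  ext a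
  simpa using hF a

end homology

/-! ### Chains as combinations of lists -/

/-- The lists of `i + 1` pairwise comparable elements of `S`. -/
def chainLists {X : Type u} [PartialOrder X] (S : Set X) (i : ℤ) : Set (List X) :=
  {l | (l.length : ℤ) = i + 1 ∧ IsChain (· ≤ ·) {v | v ∈ l} ∧ ∀ v ∈ l, v ∈ S}

/-- The `i`-chains of the order complex of `S`, as combinations of lists. -/
def listChains {X : Type u} [PartialOrder X] (S : Set X) (i : ℤ) : Submodule ℤ (List X →₀ ℤ) :=
  Finsupp.supported ℤ ℤ (chainLists S i)

/-- Every cycle of degree `i` in the order complex of `S` bounds there. -/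
def AcyclicAt {X : Type u} [PartialOrder X] (S : Set X) (i : ℤ) : Prop :=
  ∀ c ∈ listChains S i, listBoundary X c = 0 → ∃ d ∈ listChains S (i + 1), listBoundary X d = c

theorem listBoundary_single {X : Type u} (l : List X) : listBoundary X (Finsupp.single l 1) =
    ∑ k : Fin l.length, (-1 : ℤ) ^ (k : ℕ) • Finsupp.single (l.eraseIdx k) 1 := by
  simp [listBoundary]

theorem map_listBoundary_single {X : Type u} {M : Type*} [AddCommGroup M] (D : (List X →₀ ℤ) →ₗ[ℤ] M)
    (l : List X) : D (listBoundary X (Finsupp.single l 1)) =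
    ∑ k : Fin l.length, (-1 : ℤ) ^ (k : ℕ) • D (Finsupp.single (l.eraseIdx k) 1) := by
  simp only [listBoundary_single, map_sum, map_smul]

theorem listBoundary_map {V W : Type u} (f : V → W) (c : List V →₀ ℤ) :
    listBoundary W (Finsupp.lmapDomain ℤ ℤ (List.map f) c) =
      Finsupp.lmapDomain ℤ ℤ (List.map f) (listBoundary V c) := by
  have : (listBoundary W).comp (Finsupp.lmapDomain ℤ ℤ (List.map f)) =
      (Finsupp.lmapDomain ℤ ℤ (List.map f)).comp (listBoundary V) := by
    ext1 l
    ext1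
    simp only [LinearMap.comp_apply, Finsupp.lsingle_apply, Finsupp.lmapDomain_apply,
      Finsupp.mapDomain_single, listBoundary, Finsupp.linearCombination_single, one_smul]
    rw [← Finsupp.lmapDomain_apply ℤ ℤ, map_sum]
    refine Fintype.sum_equiv (finCongr (by simp)) _ _ fun k => ?_
    simp [List.eraseIdx_map, Finsupp.mapDomain_single]
  exact LinearMap.congr_fun this c

section listChains

variable {X Y : Type u} [PartialOrder X] [PartialOrder Y]

theorem single_mem_listChains {S : Set X} {i : ℤ} {l : List X} (hl : l ∈ chainLists S i) :
    Finsupp.single l 1 ∈ listChains S i :=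
  Finsupp.single_mem_supported ℤ _ hl

theorem listChains_mono {S T : Set X} (h : S ⊆ T) (i : ℤ) : listChains S i ≤ listChains T i :=
  Finsupp.supported_mono fun _ hl => ⟨hl.1, hl.2.1, fun v hv => h (hl.2.2 v hv)⟩

/-- To show that a linear map sends chains into a submodule, it suffices to check it on lists. -/
theorem map_mem_of_mem_listChains {M : Type*} [AddCommGroup M] {S : Set X} {i : ℤ}
    {D : (List X →₀ ℤ) →ₗ[ℤ] M} {T : Submodule ℤ M}
    (h : ∀ l ∈ chainLists S i, D (Finsupp.single l 1) ∈ T) {c : List X →₀ ℤ}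
    (hc : c ∈ listChains S i) : D c ∈ T := by
  rw [listChains, Finsupp.supported_eq_span_single] at hc
  have : Submodule.span ℤ ((fun l => Finsupp.single l (1 : ℤ)) '' chainLists S i) ≤ T.comap D := by
    rw [Submodule.span_le]
    rintro _ ⟨l, hl, rfl⟩
    exact h l hl
  exact this hc

/-- Two linear maps that agree on lists agree on chains. -/
theorem eq_of_mem_listChains {M : Type*} [AddCommGroup M] {S : Set X} {i : ℤ}
    {D E : (List X →₀ ℤ) →ₗ[ℤ] M}
    (h : ∀ l ∈ chainLists S i, D (Finsupp.single l 1) = E (Finsupp.single l 1)) {c : List X →₀ ℤ}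
    (hc : c ∈ listChains S i) : D c = E c := by
  have := map_mem_of_mem_listChains (D := D - E) (T := ⊥) (fun l hl => by simp [h l hl]) hc
  simpa [sub_eq_zero] using this

/-- The greatest element is comparable with every entry, and since repetitions are allowed it may
already occur in the list. -/
theorem cons_mem_listChains {S : Set X} {y : X} (hS : IsGreatest S y) {i : ℤ} {c : List X →₀ ℤ}
    (hc : c ∈ listChains S i) :
    Finsupp.lmapDomain ℤ ℤ (List.cons y) c ∈ listChains S (i + 1) := by
  refine map_mem_of_mem_listChains (fun l hl => ?_) hc
  rw [Finsupp.lmapDomain_apply, Finsupp.mapDomain_single]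
  obtain ⟨h1, h2, h3⟩ := hl
  refine single_mem_listChains ⟨by simp [h1], ?_, ?_⟩
  · have : {v | v ∈ y :: l} = insert y {v | v ∈ l} := by ext; simp
    rw [this]
    exact h2.insert fun b hb _ => Or.inr (hS.2 (h3 b hb))
  · simpa using ⟨hS.1, h3⟩

/-- Coning off with the greatest element `y` is a contraction: `∂(y c) = c - y ∂c`. This holds in
every degree, including `-1`. -/
theorem acyclicAt_of_isGreatest {S : Set X} {y : X} (hS : IsGreatest S y) (i : ℤ) :
    AcyclicAt S i := fun c hc h0 =>
  ⟨_, cons_mem_listChains hS hc, by rw [listBoundary_cons', h0, map_zero, sub_zero]⟩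

theorem isChain_map (f : X →o Y) {l : List X} (hc : IsChain (· ≤ ·) {v | v ∈ l}) :
    IsChain (· ≤ ·) {v | v ∈ l.map f} := by
  have : {v | v ∈ l.map f} = f '' {v | v ∈ l} := by ext; simp
  rw [this]
  rintro _ ⟨a, ha, rfl⟩ _ ⟨b, hb, rfl⟩ -
  exact (hc.total ha hb).imp (fun h => f.monotone h) (fun h => f.monotone h)

theorem map_mem_listChains (f : X →o Y) {S : Set X} {T : Set Y} (h : ∀ v ∈ S, f v ∈ T) {i : ℤ}
    {c : List X →₀ ℤ} (hc : c ∈ listChains S i) :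
    Finsupp.lmapDomain ℤ ℤ (List.map f) c ∈ listChains T i := by
  refine map_mem_of_mem_listChains (fun l hl => ?_) hc
  rw [Finsupp.lmapDomain_apply, Finsupp.mapDomain_single]
  obtain ⟨h1, h2, h3⟩ := hl
  refine single_mem_listChains ⟨by simp [h1], ?_, ?_⟩
  · exact isChain_map f h2
  · simpa using fun v hv => h v (h3 v hv)

end listChains

/-! ### Acyclic carriers -/

section carrier

variable {X Y : Type u} [PartialOrder X]

/-- The method of acyclic carriers. Let `h` be a map of chains that commutes with the boundary
up to the sign `-ε`, and let `T` be a carrier in which the cycles that occur bound. Then there is a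
map `D` carried by `T` with `∂ D = h + ε D ∂` on the lists of bounded length. -/
theorem exists_carried_map (ε : ℤ) (h : (List X →₀ ℤ) →ₗ[ℤ] (List Y →₀ ℤ))
    (d₀ : List Y →₀ ℤ) (T Z : List X → Submodule ℤ (List Y →₀ ℤ))
    (hd₀ : d₀ ∈ T []) (hd₀' : listBoundary Y d₀ = h (Finsupp.single [] 1)) (N : ℕ)
    (hacyclic : ∀ l : List X, l ≠ [] → l.length ≤ N → IsChain (· ≤ ·) {v | v ∈ l} →
      ∀ z ∈ Z l, listBoundary Y z = 0 → ∃ d ∈ T l, listBoundary Y d = z)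
    (hTZ : ∀ l : List X, ∀ k : Fin l.length, T (l.eraseIdx k) ≤ Z l)
    (hhZ : ∀ l : List X, l.length ≤ N → IsChain (· ≤ ·) {v | v ∈ l} →
      h (Finsupp.single l 1) ∈ Z l)
    (hh : ∀ l : List X, l.length ≤ N → IsChain (· ≤ ·) {v | v ∈ l} →
      listBoundary Y (h (Finsupp.single l 1)) = -ε • h (listBoundary X (Finsupp.single l 1))) :
    ∃ D : (List X →₀ ℤ) →ₗ[ℤ] (List Y →₀ ℤ), D (Finsupp.single [] 1) = d₀ ∧
      ∀ l : List X, l.length ≤ N → IsChain (· ≤ ·) {v | v ∈ l} →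
        D (Finsupp.single l 1) ∈ T l ∧ listBoundary Y (D (Finsupp.single l 1)) =
          h (Finsupp.single l 1) + ε • D (listBoundary X (Finsupp.single l 1)) := by
  classical
  induction N with
  | zero =>
    -- Only the value on the empty list matters; the others are arbitrary.
    refine ⟨Finsupp.linearCombination ℤ fun _ => d₀, by simp, fun l hl _ => ?_⟩
    obtain rfl : l = [] := by simpa using hl
    simpa [listBoundary_single] using ⟨hd₀, hd₀'⟩
  | succ N ih =>
    obtain ⟨D, hD0, hD⟩ := ih (fun l h1 h2 => hacyclic l h1 (by omega))
      (fun l h1 => hhZ l (by omega)) (fun l h1 => hh l (by omega))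
    have hmem (l : List X) (hl : IsChain (· ≤ ·) {v | v ∈ l}) (k : Fin l.length) :
        IsChain (· ≤ ·) {v | v ∈ l.eraseIdx k} :=
      hl.mono fun v hv => List.mem_of_mem_eraseIdx hv
    have key (l : List X) (hlen : l.length = N + 1) (hl : IsChain (· ≤ ·) {v | v ∈ l}) :
        ∃ d ∈ T l, listBoundary Y d =
          h (Finsupp.single l 1) + ε • D (listBoundary X (Finsupp.single l 1)) := by
      have hlen' (k : Fin l.length) : (l.eraseIdx k).length ≤ N := by
        rw [List.length_eraseIdx_of_lt k.2]; omega
      apply hacyclic l (by rintro rfl; simp at hlen) hlen.le hl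
      · refine add_mem (hhZ l hlen.le hl) (Submodule.smul_mem _ _ ?_)
        rw [map_listBoundary_single]
        exact sum_mem fun k _ => Submodule.smul_mem _ _
          (hTZ l k (hD _ (hlen' k) (hmem l hl k)).1)
      -- The prescribed boundary of `D l` is a cycle: `∂(h l + ε D ∂l) = -ε h ∂l + ε (h ∂l + ε D
      -- ∂∂l) = 0`, by the inductive formula on each face of `l`.
      · have : listBoundary Y (D (listBoundary X (Finsupp.single l 1))) =
            h (listBoundary X (Finsupp.single l 1)) +
              ε • D (listBoundary X (listBoundary X (Finsupp.single l 1))) := by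
          simp only [listBoundary_single l, map_sum, map_smul, Finset.smul_sum,
            ← Finset.sum_add_distrib]
          refine Finset.sum_congr rfl fun k _ => ?_
          rw [(hD _ (hlen' k) (hmem l hl k)).2, smul_add, smul_comm ε]
        rw [map_add, map_smul, this, listBoundary_listBoundary, map_zero, smul_zero, add_zero,
          hh l hlen.le hl, neg_smul, neg_add_cancel]
    choose! d hdT hd using key
    -- Only values in length `N + 1` are changed, so the formulas in smaller lengths survive. On
    -- lists that are not chains, `d` is unspecified.
    let D' : (List X →₀ ℤ) →ₗ[ℤ] (List Y →₀ ℤ) := Finsupp.linearCombination ℤ fun l =>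
      if l.length = N + 1 then d l else D (Finsupp.single l 1)
    have hD' (l : List X) (hl : l.length ≤ N) :
        D' (Finsupp.single l 1) = D (Finsupp.single l 1) := by
      simp [D', show l.length ≠ N + 1 by omega]
    have hDd (l : List X) (hl : l.length ≤ N + 1) :
        D' (listBoundary X (Finsupp.single l 1)) = D (listBoundary X (Finsupp.single l 1)) := by
      rw [map_listBoundary_single, map_listBoundary_single]
      refine Finset.sum_congr rfl fun k _ => ?_
      have := k.2
      rw [hD' _ (by rw [List.length_eraseIdx_of_lt k.2]; omega)]
    refine ⟨D', by rw [hD' _ (by simp), hD0], fun l hl hc => ?_⟩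
    rw [hDd l hl]
    rcases Nat.lt_or_ge N l.length with hN | hN
    · have hN' : l.length = N + 1 := by omega
      have : D' (Finsupp.single l 1) = d l := by simp [D', hN']
      rw [this]
      exact ⟨hdT l hN' hc, hd l hN' hc⟩
    · rw [hD' l hN]
      exact hD l hN hc

end carrier

/-! ### The homotopy inverse in low degrees -/

theorem length_eraseIdx_intCast {Y : Type u} (l : List Y) (k : Fin l.length) :
    ((l.eraseIdx k).length : ℤ) = l.length - 1 := by
  have := List.length_eraseIdx_of_lt k.2
  have := k.2
  omega

section homotopyInverse

variable {X Y : Type u} [PartialOrder X] [PartialOrder Y]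

/-- The lower set generated by the entries of a list. -/
def listLower (l : List Y) : Set Y := {y | ∃ v ∈ l, y ≤ v}

theorem listLower_eraseIdx_subset (l : List Y) (k : ℕ) : listLower (l.eraseIdx k) ⊆ listLower l :=
  fun _ ⟨v, hv, h⟩ => ⟨v, List.mem_of_mem_eraseIdx hv, h⟩

/-- The generator is the maximum of the chain. The carriers are thus the sets `U_y` and their
preimages, while the description by generated lower sets also makes sense for the empty list and is
visibly monotone under faces. -/
theorem exists_listLower_eq_Iic {l : List Y} (hl : l ≠ []) (hc : IsChain (· ≤ ·) {v | v ∈ l}) :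
    ∃ y, listLower l = Set.Iic y := by
  obtain ⟨y, hy, hmax⟩ := (List.finite_toSet l).exists_maximal
    (List.exists_mem_of_ne_nil l hl)
  refine ⟨y, Set.ext fun x => ⟨fun ⟨v, hv, hx⟩ => hx.trans ?_, fun hx => ⟨y, hy, hx⟩⟩⟩
  exact (hc.total hv hy).elim id fun h => hmax hv h

theorem nil_mem_chainLists (S : Set X) : [] ∈ chainLists S (-1) :=
  ⟨by simp, by simp [IsChain], by simp⟩

theorem mem_chainLists_listLower {l : List Y} (hc : IsChain (· ≤ ·) {v | v ∈ l}) :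
    l ∈ chainLists (listLower l) (l.length - 1) :=
  ⟨by simp, hc, fun v hv => ⟨v, hv, le_rfl⟩⟩

/-- If the fibres `f⁻¹(U_y)` are acyclic up to degree `n`, then there is a chain map from `Y` to `X`
up to degree `n + 1`, carried by these fibres. -/
theorem exists_carried_chainMap (f : X →o Y) (n : ℕ)
    (hac : ∀ y : Y, ∀ i : ℤ, i ≤ n → AcyclicAt (f ⁻¹' Set.Iic y) i) :
    ∃ g : (List Y →₀ ℤ) →ₗ[ℤ] (List X →₀ ℤ),
      g (Finsupp.single [] 1) = Finsupp.single [] 1 ∧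
      ∀ l : List Y, l.length ≤ n + 2 → IsChain (· ≤ ·) {v | v ∈ l} →
        g (Finsupp.single l 1) ∈ listChains (f ⁻¹' listLower l) (l.length - 1) ∧
        listBoundary X (g (Finsupp.single l 1)) = g (listBoundary Y (Finsupp.single l 1)) := by
  -- With `ε = 1` and `h = 0` the formula reads `∂ g = g ∂`. A list of length at most `n + 2`
  -- requires bounding in degree at most `n`.
  have := exists_carried_map (X := Y) (Y := X) 1 0 (Finsupp.single [] 1)
    (fun l => listChains (f ⁻¹' listLower l) (l.length - 1))
    (fun l => listChains (f ⁻¹' listLower l) (l.length - 1 - 1))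
    (single_mem_listChains (nil_mem_chainLists _)) (by simp [listBoundary_single]) (n + 2)
    (fun l hl hN hc z hz h0 => by
      obtain ⟨y, hy⟩ := exists_listLower_eq_Iic hl hc
      rw [hy] at hz ⊢
      simpa using hac y _ (by omega) z hz h0)
    (fun l k => by
      rw [length_eraseIdx_intCast]
      exact listChains_mono (Set.preimage_mono (listLower_eraseIdx_subset l k)) _)
    (by simp) (by simp)
  simpa using this

/-- The composite `Y → X → Y` is homotopic to the identity up to degree `n + 1`. -/
theorem exists_homotopy_target (f : X →o Y) (n : ℕ) (g : (List Y →₀ ℤ) →ₗ[ℤ] (List X →₀ ℤ))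
    (hg0 : g (Finsupp.single [] 1) = Finsupp.single [] 1)
    (hg : ∀ l : List Y, l.length ≤ n + 2 → IsChain (· ≤ ·) {v | v ∈ l} →
        g (Finsupp.single l 1) ∈ listChains (f ⁻¹' listLower l) (l.length - 1) ∧
        listBoundary X (g (Finsupp.single l 1)) = g (listBoundary Y (Finsupp.single l 1))) :
    ∃ D : (List Y →₀ ℤ) →ₗ[ℤ] (List Y →₀ ℤ),
      ∀ l : List Y, l.length ≤ n + 2 → IsChain (· ≤ ·) {v | v ∈ l} →
        D (Finsupp.single l 1) ∈ listChains (listLower l) l.length ∧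
        listBoundary Y (D (Finsupp.single l 1)) =
          Finsupp.lmapDomain ℤ ℤ (List.map f) (g (Finsupp.single l 1)) - Finsupp.single l 1
            - D (listBoundary Y (Finsupp.single l 1)) := by
  -- With `ε = -1` and `h = f g - id` the formula is that of a homotopy; it starts at `0` because `f
  -- g` fixes the empty list. Cones are acyclic in all degrees, so the bound `n + 2` comes from `g`
  -- alone.
  obtain ⟨D, -, hD⟩ := exists_carried_map (X := Y) (Y := Y) (-1)
    (Finsupp.lmapDomain ℤ ℤ (List.map f) ∘ₗ g - LinearMap.id) 0
    (fun l => listChains (listLower l) l.length)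
    (fun l => listChains (listLower l) (l.length - 1))
    (zero_mem _) (by simp [hg0, Finsupp.mapDomain_single]) (n + 2)
    (fun l hl hN hc z hz h0 => by
      obtain ⟨y, hy⟩ := exists_listLower_eq_Iic hl hc
      rw [hy] at hz ⊢
      simpa using acyclicAt_of_isGreatest isGreatest_Iic _ z hz h0)
    (fun l k => by
      rw [length_eraseIdx_intCast]
      exact listChains_mono (listLower_eraseIdx_subset l k) _)
    (fun l hN hc => sub_mem (map_mem_listChains f (fun _ h => h) (hg l hN hc).1)
      (single_mem_listChains (mem_chainLists_listLower hc)))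
    (fun l hN hc => by
      simp only [LinearMap.sub_apply, LinearMap.comp_apply, LinearMap.id_apply, map_sub,
        listBoundary_map, (hg l hN hc).2, neg_neg, one_smul])
  refine ⟨D, fun l hN hc => ⟨(hD l hN hc).1, ?_⟩⟩
  rw [(hD l hN hc).2]
  simp [sub_eq_add_neg]

/-- The composite `X → Y → X` is homotopic to the identity up to degree `n`. -/
theorem exists_homotopy_source (f : X →o Y) (n : ℕ)
    (hac : ∀ y : Y, ∀ i : ℤ, i ≤ n → AcyclicAt (f ⁻¹' Set.Iic y) i)
    (g : (List Y →₀ ℤ) →ₗ[ℤ] (List X →₀ ℤ))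
    (hg0 : g (Finsupp.single [] 1) = Finsupp.single [] 1)
    (hg : ∀ l : List Y, l.length ≤ n + 2 → IsChain (· ≤ ·) {v | v ∈ l} →
        g (Finsupp.single l 1) ∈ listChains (f ⁻¹' listLower l) (l.length - 1) ∧
        listBoundary X (g (Finsupp.single l 1)) = g (listBoundary Y (Finsupp.single l 1))) :
    ∃ E : (List X →₀ ℤ) →ₗ[ℤ] (List X →₀ ℤ),
      ∀ l : List X, l.length ≤ n + 1 → IsChain (· ≤ ·) {v | v ∈ l} →
        E (Finsupp.single l 1) ∈ listChains (f ⁻¹' listLower (l.map f)) l.length ∧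
        listBoundary X (E (Finsupp.single l 1)) =
          g (Finsupp.lmapDomain ℤ ℤ (List.map f) (Finsupp.single l 1)) - Finsupp.single l 1
            - E (listBoundary X (Finsupp.single l 1)) := by
  have hg' (l : List X) (hN : l.length ≤ n + 1) (hc : IsChain (· ≤ ·) {v | v ∈ l}) :=
    hg (l.map f) (by simp; omega) (isChain_map f hc)
  -- A list of length `k` now requires a cycle of degree `k - 1` to bound in a fibre, whence the
  -- bound `n + 1`, one less than for `g`.
  obtain ⟨E, -, hE⟩ := exists_carried_map (X := X) (Y := X) (-1)
    (g ∘ₗ Finsupp.lmapDomain ℤ ℤ (List.map f) - LinearMap.id) 0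
    (fun l => listChains (f ⁻¹' listLower (l.map f)) l.length)
    (fun l => listChains (f ⁻¹' listLower (l.map f)) (l.length - 1))
    (zero_mem _) (by simp [hg0, Finsupp.mapDomain_single]) (n + 1)
    (fun l hl hN hc z hz h0 => by
      obtain ⟨y, hy⟩ := exists_listLower_eq_Iic (l := l.map f) (by simpa using hl)
        (isChain_map f hc)
      rw [hy] at hz ⊢
      simpa using hac y _ (by omega) z hz h0)
    (fun l k => by
      rw [length_eraseIdx_intCast, ← List.eraseIdx_map]
      exact listChains_mono (Set.preimage_mono (listLower_eraseIdx_subset _ k)) _)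
    (fun l hN hc => by
      refine sub_mem ?_ (single_mem_listChains ⟨by simp, hc, fun v hv =>
        ⟨f v, List.mem_map_of_mem hv, le_rfl⟩⟩)
      simpa [Finsupp.mapDomain_single] using (hg' l hN hc).1)
    (fun l hN hc => by
      have := (hg' l hN hc).2
      rw [← Finsupp.mapDomain_single, ← Finsupp.lmapDomain_apply ℤ ℤ, listBoundary_map] at this
      simp only [LinearMap.sub_apply, LinearMap.comp_apply, LinearMap.id_apply, map_sub,
        this, neg_neg, one_smul])
  refine ⟨E, fun l hN hc => ⟨(hE l hN hc).1, ?_⟩⟩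
  rw [(hE l hN hc).2]
  simp [sub_eq_add_neg]

/-- Surjectivity on homology up to degree `n + 1` and injectivity up to degree `n`, for
combinations of lists. -/
theorem lift_cycle_and_boundary (f : X →o Y) (n : ℕ)
    (hac : ∀ y : Y, ∀ i : ℤ, i ≤ n → AcyclicAt (f ⁻¹' Set.Iic y) i) :
    (∀ i : ℤ, i ≤ n + 1 → ∀ c ∈ listChains (Set.univ : Set Y) i, listBoundary Y c = 0 →
      ∃ b ∈ listChains (Set.univ : Set X) i, listBoundary X b = 0 ∧
        ∃ w ∈ listChains (Set.univ : Set Y) (i + 1),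
          c = Finsupp.lmapDomain ℤ ℤ (List.map f) b + listBoundary Y w) ∧
    (∀ i : ℤ, i ≤ n → ∀ b ∈ listChains (Set.univ : Set X) i, listBoundary X b = 0 →
      ∀ w ∈ listChains (Set.univ : Set Y) (i + 1),
        Finsupp.lmapDomain ℤ ℤ (List.map f) b = listBoundary Y w →
        ∃ v ∈ listChains (Set.univ : Set X) (i + 1), b = listBoundary X v) := by
  obtain ⟨g, hg0, hg⟩ := exists_carried_chainMap f n hac
  obtain ⟨D, hD⟩ := exists_homotopy_target f n g hg0 hg
  obtain ⟨E, hE⟩ := exists_homotopy_source f n hac g hg0 hg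
  have g_mem {i : ℤ} (hi : i ≤ n + 1) {c} (hc : c ∈ listChains (Set.univ : Set Y) i) :
      g c ∈ listChains (Set.univ : Set X) i :=
    map_mem_of_mem_listChains (fun l ⟨h1, h2, _⟩ => by
      obtain rfl : i = l.length - 1 := by omega
      exact listChains_mono (Set.subset_univ _) _ (hg l (by omega) h2).1) hc
  have g_comm {i : ℤ} (hi : i ≤ n + 1) {c} (hc : c ∈ listChains (Set.univ : Set Y) i) :
      listBoundary X (g c) = g (listBoundary Y c) :=
    eq_of_mem_listChains (D := listBoundary X ∘ₗ g) (E := g ∘ₗ listBoundary Y)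
      (fun l ⟨h1, h2, _⟩ => (hg l (by omega) h2).2) hc
  constructor
  · intro i hi c hc h0
    -- Since `∂c = 0`, the homotopy formula becomes `∂ D c = f g c - c`.
    refine ⟨g c, g_mem hi hc, by rw [g_comm hi hc, h0, map_zero], -D c, neg_mem ?_, ?_⟩
    · refine map_mem_of_mem_listChains (fun l ⟨h1, h2, _⟩ => ?_) hc
      rw [← h1]
      exact listChains_mono (Set.subset_univ _) _ (hD l (by omega) h2).1
    · have := eq_of_mem_listChains (D := listBoundary Y ∘ₗ D)
        (E := Finsupp.lmapDomain ℤ ℤ (List.map f) ∘ₗ g - LinearMap.id - D ∘ₗ listBoundary Y)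
        (fun l ⟨h1, h2, _⟩ => (hD l (by omega) h2).2) hc
      simp only [LinearMap.sub_apply, LinearMap.comp_apply, LinearMap.id_apply, h0, map_zero,
        sub_zero] at this
      rw [map_neg, this]
      abel
  · intro i hi b hb h0 w hw hbw
    -- Here `∂ E b = g f b - b` and `g f b = g ∂w = ∂ g w`; the last equality uses `g` in degree `i
    -- + 1 ≤ n + 1`.
    refine ⟨g w - E b, sub_mem (g_mem (by omega) hw) ?_, ?_⟩
    · refine map_mem_of_mem_listChains (fun l ⟨h1, h2, _⟩ => ?_) hb
      rw [← h1]
      exact listChains_mono (Set.subset_univ _) _ (hE l (by omega) h2).1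
    · have := eq_of_mem_listChains (D := listBoundary X ∘ₗ E)
        (E := g ∘ₗ Finsupp.lmapDomain ℤ ℤ (List.map f) - LinearMap.id - E ∘ₗ listBoundary X)
        (fun l ⟨h1, h2, _⟩ => (hE l (by omega) h2).2) hb
      simp only [LinearMap.sub_apply, LinearMap.comp_apply, LinearMap.id_apply, h0, map_zero,
        sub_zero] at this
      rw [map_sub, g_comm (by omega) hw, this, hbw]
      abel

end homotopyInverse

/-! ### Comparison with the augmented ordered chain complex -/

section comparison

variable {X Y : Type u} [PartialOrder X] [PartialOrder Y]

theorem mem_chainLists_univ_iff (l : List X) (i : ℤ) : l ∈ chainLists (Set.univ : Set X) i ↔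
    (l.length : ℤ) = i + 1 ∧
      (l = [] ∨ (open Classical in l.toFinset) ∈ (orderComplex X).faces) := by
  classical
  refine and_congr_right fun _ => ?_
  have hs : ((open Classical in l.toFinset : Finset X) : Set X) = {v | v ∈ l} := by ext; simp
  change _ ↔ l = [] ∨ (Finset.Nonempty _ ∧ IsChain (· ≤ ·) _)
  rw [hs, List.toFinset_nonempty_iff]
  by_cases hl : l = []
  · simp [hl, IsChain]
  · simp [hl]

/-- The chains of a simplicial complex, as combinations of lists. -/
noncomputable def chainToLists {V : Type u} (K : AbstractSimplicialComplex V) (i : ℤ) :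
    K.augmentedChainComplex.X i →ₗ[ℤ] (List V →₀ ℤ) :=
  K.toLists i

theorem chainToLists_injective {V : Type u} (K : AbstractSimplicialComplex V) (i : ℤ) :
    Function.Injective (chainToLists K i) :=
  K.toLists_injective i

/-- Together with injectivity, this lets statements about `listChains` be transferred to the chain
complex and back. -/
theorem range_chainToLists (X : Type u) [PartialOrder X] (i : ℤ) :
    LinearMap.range (chainToLists (orderComplex X) i) = listChains (Set.univ : Set X) i := by
  change LinearMap.range ((orderComplex X).toLists i) = _
  apply le_antisymm
  · rintro _ ⟨x, rfl⟩
    induction x using Finsupp.induction_linear with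
    | zero => simp
    | add x y hx hy => rw [map_add]; exact add_mem hx hy
    | single σ a =>
      rw [toLists, Finsupp.lmapDomain_apply, Finsupp.mapDomain_single]
      exact Finsupp.single_mem_supported ℤ _ ((mem_chainLists_univ_iff _ _).2 σ.2)
  · rw [listChains, Finsupp.supported_eq_span_single, Submodule.span_le]
    rintro _ ⟨l, hl, rfl⟩
    let σ : OrderedSimplex (orderComplex X) i := ⟨l, (mem_chainLists_univ_iff _ _).1 hl⟩
    exact ⟨Finsupp.single σ 1, Finsupp.mapDomain_single⟩

/-- The degrees are related by an equation so that the lemma also applies to the differential from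
`i` to `i - 1`. -/
theorem chainToLists_d {V : Type u} (K : AbstractSimplicialComplex V) {i j : ℤ}
    (hij : j + 1 = i) (x : K.augmentedChainComplex.X i) :
    chainToLists K j (K.augmentedChainComplex.d i j x) = listBoundary V (chainToLists K i x) := by
  subst hij
  rw [augmentedChainComplex_d]
  exact K.toLists_boundary j x

theorem chainToLists_augmentedChainMap (f : X →o Y) (i : ℤ)
    (x : (orderComplex X).augmentedChainComplex.X i) :
    chainToLists (orderComplex Y) i ((orderComplexMap f).augmentedChainMap.f i x) =
      Finsupp.lmapDomain ℤ ℤ (List.map f) (chainToLists (orderComplex X) i x) := by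
  have : (orderComplex Y).toLists i ∘ₗ (orderComplexMap f).chainMap i =
      Finsupp.lmapDomain ℤ ℤ (List.map f) ∘ₗ (orderComplex X).toLists i := by
    ext1 σ
    ext1
    simp only [toLists, SimplicialMap.chainMap, LinearMap.comp_apply, Finsupp.lsingle_apply,
      Finsupp.lmapDomain_apply, Finsupp.mapDomain_single]
    rfl
  exact LinearMap.congr_fun this x

/-- Vanishing of reduced homology, in terms of combinations of lists. -/
theorem acyclicAt_univ_of_isZero {i : ℤ} (h : IsZero ((orderComplex X).reducedHomology i)) :
    AcyclicAt (Set.univ : Set X) i := by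
  intro c hc h0
  have hex : (orderComplex X).augmentedChainComplex.ExactAt i :=
    (HomologicalComplex.exactAt_iff_isZero_homology _ _).2 h
  rw [HomologicalComplex.exactAt_iff' _ (i + 1) i (i - 1) (by simp) (by simp),
    ShortComplex.moduleCat_exact_iff] at hex
  rw [← range_chainToLists] at hc
  obtain ⟨x, rfl⟩ := hc
  have hx : (orderComplex X).augmentedChainComplex.d i (i - 1) x = 0 :=
    chainToLists_injective _ _ (by rw [chainToLists_d _ (by simp), h0, map_zero])
  obtain ⟨y, hy⟩ : ∃ y, (orderComplex X).augmentedChainComplex.d (i + 1) i y = x := hex x hx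
  refine ⟨chainToLists _ (i + 1) y, ?_, ?_⟩
  · rw [← range_chainToLists]
    exact ⟨y, rfl⟩
  · rw [← chainToLists_d _ rfl, hy]

/-- Acyclicity of a subset may be checked in the subset, viewed as a poset on its own. -/
theorem acyclicAt_of_coe {S : Set X} {i : ℤ} (h : AcyclicAt (Set.univ : Set S) i) :
    AcyclicAt S i := by
  let ι : S →o X := ⟨Subtype.val, fun _ _ h => h⟩
  have hinj : Function.Injective (Finsupp.lmapDomain ℤ ℤ (List.map ι)) :=
    Finsupp.mapDomain_injective (List.map_injective_iff.2 Subtype.val_injective)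
  have hrange : ∀ c ∈ listChains S i, ∃ b ∈ listChains (Set.univ : Set S) i,
      Finsupp.lmapDomain ℤ ℤ (List.map ι) b = c := by
    intro c hc
    refine map_mem_of_mem_listChains (D := LinearMap.id)
      (T := (listChains (Set.univ : Set S) i).map (Finsupp.lmapDomain ℤ ℤ (List.map ι)))
      (fun l ⟨h1, h2, h3⟩ => ?_) hc
    lift l to List S using h3
    refine ⟨Finsupp.single l 1, single_mem_listChains ⟨by simpa using h1, ?_, by simp⟩, ?_⟩
    · intro a ha b hb hab
      exact h2 (List.mem_map_of_mem ha) (List.mem_map_of_mem hb)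
        (by simpa [Subtype.ext_iff] using hab)
    · rw [Finsupp.lmapDomain_apply, Finsupp.mapDomain_single]
      rfl
  intro c hc h0
  obtain ⟨b, hb, rfl⟩ := hrange c hc
  -- Pushforward along the inclusion is injective and commutes with `∂`, so the preimage `b` is
  -- again a cycle.
  obtain ⟨d, hd, hdb⟩ := h b hb (hinj (by rw [← listBoundary_map, h0, map_zero]))
  exact ⟨_, map_mem_listChains ι (fun v _ => v.2) hd, by rw [listBoundary_map, hdb]⟩

end comparison

theorem theorem5p3 {X Y : Type u} [PartialOrder X] [Finite X] [PartialOrder Y] [Finite Y]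
    (f : X →o Y) (n : ℕ)
    (h : ∀ y : Y, ∀ i : ℤ, i ≤ n →
      IsZero ((orderComplex (f ⁻¹' Set.Iic y)).reducedHomology i)) :
    (∀ i : ℤ, i ≤ n → IsIso ((orderComplexMap f).reducedHomologyMap i)) ∧
      Epi ((orderComplexMap f).reducedHomologyMap (n + 1)) := by
  obtain ⟨hsurj, hinj⟩ := lift_cycle_and_boundary f n fun y i hi =>
    acyclicAt_of_coe (acyclicAt_univ_of_isZero (h y i hi))
  -- Quantifiers over `listChains` become quantifiers over elements of the complexes, as the
  -- homology criteria require.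
  simp only [← range_chainToLists, LinearMap.mem_range, forall_exists_index,
    forall_apply_eq_imp_iff, exists_exists_eq_and] at hsurj hinj
  have hepi (i : ℤ) (hi : i ≤ n + 1) : Epi ((orderComplexMap f).reducedHomologyMap i) := by
    refine epi_homologyMap_of_elements _ (i + 1) i (i - 1) (by simp) (by simp) fun y hy => ?_
    obtain ⟨x, hx, w, hw⟩ := hsurj i hi y (by
      rw [← chainToLists_d (j := i - 1) _ (by simp), hy, map_zero])
    refine ⟨x, chainToLists_injective _ (i - 1) ?_, w,
      chainToLists_injective _ i (hw.trans ?_)⟩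
    · rw [chainToLists_d _ (by simp), map_zero]
      exact hx
    · rw [map_add, chainToLists_augmentedChainMap, chainToLists_d _ rfl]
  refine ⟨fun i hi => ?_, hepi _ le_rfl⟩
  have := hepi i (by omega)
  have : Mono ((orderComplexMap f).reducedHomologyMap i) := by
    refine mono_homologyMap_of_elements _ (i + 1) i (i - 1) (by simp) (by simp)
      fun x hx w hw => ?_
    obtain ⟨v, hv⟩ := hinj i hi x (by
      rw [← chainToLists_d (j := i - 1) _ (by simp), hx, map_zero]) w (by
      rw [← chainToLists_augmentedChainMap, hw, chainToLists_d _ rfl])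
    refine ⟨v, chainToLists_injective _ i (hv.trans ?_)⟩
    rw [chainToLists_d _ rfl]
  exact isIso_of_mono_of_epi _
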